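/- Let $(\Lambda,\mu)$ be a probability space (the parameter space with the distribution of the random parameter $\boldsymbol y$), and let $s_h$ (high-fidelity output) and $s_{N_1},\dots,s_{N_L}$ (reduced basis outputs, from the finest to the coarsest) be real, square-integrable functions on $\Lambda$. Write $E[f]=\int_\Lambda f\,d\mu$ and let $V[f]$ be the variance of $f$ under $\mu$. Define the level differences $$z_0 = s_h - s_{N_1},\qquad z_\ell = s_{N_\ell}-s_{N_{\ell+1}}\ (1\le \ell\le L-1),\qquad z_L = s_{N_L}$$ (with $z_0=s_h$ if $L=0$). Let $\boldsymbol y^\ell_m$ ($0\le \ell\le L$, $m\ge 1$) be mutually independent random samples with distribution $\mu$, and put $$E_{M}[z_\ell]=\frac1{M}\sum_{m=1}^{M} z_\ell(\boldsymbol y^\ell_m),\qquad V_{M}[z_\ell]=\frac1{M-1}\sum_{m=1}^{M}\bigl(E_{M}[z_\ell]-z_\ell(\boldsymbol y^\ell_m)\bigr)^2,\qquad E_{M_0,\dots,M_L}[s_h]=\sum_{\ell=0}^L E_{M_\ell}[z_\ell].$$ (i) For all $M_0,\dots,M_L\ge1$, $E_{M_0,\dots,M_L}[s_h]$ is integrable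 and is an unbiased estimate of $E[s_h]$: its expectation equals $E[s_h]$. (ii) Suppose that $V[z_\ell]\neq0$ for at least one $\ell\in\{0,\dots,L\}$. Then for every $a>0$ $$\lim_{M_0\to\infty}\lim_{M_1\to\infty}\cdots\lim_{M_L\to\infty}\Pr\Bigl(\bigl|E[s_h]-E_{M_0,\dots,M_L}[s_h]\bigr|\le \Delta^E_{M_0,\dots,M_L}\Bigr)=\operatorname{erf}\Bigl(\frac a{\sqrt2}\Bigr),\qquad \Delta^E_{M_0,\dots,M_L}=a\sqrt{\sum_{\ell=0}^L\frac{V_{M_\ell}[z_\ell]}{M_\ell}},$$ where $\operatorname{erf}(x)=\frac{2}{\sqrt\pi}\int_0^x e^{-t^2}\,dt$, the limits are iterated (the innermost over $M_L$), and every inner limit exists for all values $\ge2$ of the outer sample sizes. The two-level case is $L=1$. -/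

import Mathlib

open MeasureTheory ProbabilityTheory Filter Topology

noncomputable section

/-- The error function `erf x = (2 / √π) ∫₀ˣ exp (-t²) dt`. -/
def erf (x : ℝ) : ℝ := 2 / Real.sqrt Real.pi * ∫ t in (0 : ℝ)..x, Real.exp (-t ^ 2)

/-- The level differences of a high-fidelity output `sh` and the `L` reduced outputs
`sN 0, …, sN (L - 1)` (from the finest to the coarsest):
`z 0 = sh - sN 0`, `z ℓ = sN (ℓ - 1) - sN ℓ` for `0 < ℓ < L`, and `z L = sN (L - 1)`. -/
def levelDiff {Λ : Type*} {L : ℕ} (sh : Λ → ℝ) (sN : Fin L → Λ → ℝ)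
    (l : Fin (L + 1)) (y : Λ) : ℝ :=
  (Fin.cons sh sN : Fin (L + 1) → Λ → ℝ) l y -
    (Fin.snoc sN (fun _ => 0) : Fin (L + 1) → Λ → ℝ) l y

/-- The Monte Carlo mean `(1 / M) ∑ f (Y m)` over the first `M` samples. -/
def sampleMean {Ω Λ : Type*} (f : Λ → ℝ) (Y : ℕ → Ω → Λ) (M : ℕ) (ω : Ω) : ℝ :=
  1 / (M : ℝ) * ∑ m ∈ Finset.range M, f (Y m ω)

/-- The sample variance `(1 / (M - 1)) ∑ (mean - f (Y m))²` over the first `M` samples. -/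
def sampleVariance {Ω Λ : Type*} (f : Λ → ℝ) (Y : ℕ → Ω → Λ) (M : ℕ) (ω : Ω) : ℝ :=
  1 / ((M : ℝ) - 1) * ∑ m ∈ Finset.range M, (sampleMean f Y M ω - f (Y m ω)) ^ 2

/-- The multilevel estimate of the expectation of `sh`: the sum over the levels of the Monte Carlo
means of the level differences, level `l` using the first `M l` samples of the sequence `Y l`. -/
def mvrEstimate {Ω Λ : Type*} {L : ℕ} (sh : Λ → ℝ) (sN : Fin L → Λ → ℝ)
    (Y : Fin (L + 1) → ℕ → Ω → Λ) (M : Fin (L + 1) → ℕ) (ω : Ω) : ℝ :=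
  ∑ l, sampleMean (levelDiff sh sN l) (Y l) (M l) ω

/-- The error bound `a * √(∑ l, V_{M l}[z l] / M l)`. -/
def mvrErrorBound {Ω Λ : Type*} {L : ℕ} (a : ℝ) (sh : Λ → ℝ) (sN : Fin L → Λ → ℝ)
    (Y : Fin (L + 1) → ℕ → Ω → Λ) (M : Fin (L + 1) → ℕ) (ω : Ω) : ℝ :=
  a * Real.sqrt (∑ l, sampleVariance (levelDiff sh sN l) (Y l) (M l) ω / (M l : ℝ))

/-- The iterated limit `lim_{M 0 → ∞} lim_{M 1 → ∞} … lim_{M (n - 1) → ∞} F M = c`, for a quantity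
`F` that is defined for sample sizes at least two. The innermost limit is the one over the last
size, and every inner limit is required to exist, for all values `≥ 2` of the outer sizes. -/
def HasIteratedLimit : (n : ℕ) → ((Fin n → ℕ) → ℝ) → ℝ → Prop
  | 0, F, c => F Fin.elim0 = c
  | n + 1, F, c => ∃ g : ℕ → ℝ,
      (∀ m, 2 ≤ m → HasIteratedLimit n (fun M => F (Fin.cons m M)) (g m)) ∧
        Tendsto g atTop (𝓝 c)

end

/-!
The level differences telescope, so the estimate is the sum over the levels of independent sample
means, and unbiasedness is linearity of the expectation.

For the coverage statement, write `D l` for the error of level `l` and `S l` for its variance term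
`V_M[z l] / M`. The event is `|∑ D l| ≤ a * √(∑ S l)`. The iterated limit is computed from the
innermost level outwards, keeping track of the error `d` and the variance term `s ≥ 0` that the outer
levels contribute. Once the inner limits are taken there is a function `φ d s`, equal to `1` if
`|d| < a * √s`, to `0` if `|d| > a * √s`, and to some number in `[0, 1]` if `|d| = a * √s`. By
independence of the levels, adding a further outer level replaces `φ d s` by the mean of
`φ (d + D) (s + S)` (`HasIteratedLimit.integral` moves the iterated limit through this mean), which
lies between the probabilities of `|d + D| < a * √(s + S)` and `|d + D| ≤ a * √(s + S)`. Hence it is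
enough that these two have a common limit for each single level of nonzero variance, while a level
of zero variance contributes nothing; this is the induction
`exists_hasIteratedLimit_coverage`.

Equality `|d| = a * √s` may have positive probability for the sample sizes of the outer levels, for
instance with discrete outputs, so the limit has to be shown to exist there as well. For a single
level (`hasCoverageLimit_of_tendstoInDistribution`), the suitably scaled margin
`|d + D| - a * √(s + S)` converges in distribution, by the central limit theorem, the strong law for
the sample variance and Slutsky's theorem, to a variable without an atom at `0`: a nonzero constant
away from the boundary, `|Z| - a * σ` at `d = s = 0` and `±Z` at the other boundary points, with `Z`
a centred normal variable of variance `σ ^ 2`. At `d = s = 0` the limiting probability is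
`P(|Z| ≤ a * σ) = erf (a / √2)`, and this is the value of the whole iterated limit.
-/

/-! ### Independence of grouped families -/

/-- In a mutually independent family indexed by pairs `(i, j)`, the processes `j ↦ X i j` are
mutually independent. -/
lemma iIndepFun_curry {Ω ι κ E : Type*} [MeasurableSpace Ω] [MeasurableSpace E] [Countable ι]
    [Countable κ] {P : Measure Ω} {X : ι → κ → Ω → E} (hX : ∀ i j, AEMeasurable (X i j) P)
    (h : iIndepFun (fun p : ι × κ => X p.1 p.2) P) :
    iIndepFun (fun i ω => (X i · ω)) P := by
  have := h.isProbabilityMeasure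
  have hp : ∀ i j, IsProbabilityMeasure (P.map (X i j)) :=
    fun i j => Measure.isProbabilityMeasure_map (hX i j)
  have hσ : iIndepFun (fun p : (_ : ι) × κ => X p.1 p.2) P :=
    h.precomp (Equiv.sigmaEquivProd ι κ).injective
  have hrow : ∀ i, iIndepFun (X i) P := fun i =>
    h.precomp (g := fun j => (i, j)) (fun _ _ hj => (Prod.ext_iff.1 hj).2)
  have hcomp : (MeasurableEquiv.piCurry (fun (_ : ι) (_ : κ) => E)) ∘
      (fun ω (p : (_ : ι) × κ) => X p.1 p.2 ω) = fun ω i j => X i j ω := by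
    ext; simp [Sigma.curry]
  rw [iIndepFun_iff_map_fun_eq_infinitePi_map₀' (fun i => aemeasurable_pi_iff.2 (hX i)), ← hcomp,
    ← AEMeasurable.map_map_of_aemeasurable (by fun_prop)
      (aemeasurable_pi_iff.2 fun p : (_ : ι) × κ => hX p.1 p.2)]
  rw [iIndepFun.map_fun_eq_infinitePi_map₀' (X := fun (p : (_ : ι) × κ) => X p.1 p.2)
      (fun p => hX p.1 p.2) hσ, Measure.infinitePi_map_piCurry (fun i j => P.map (X i j))]
  congrm Measure.infinitePi fun i => ?_
  rw [(hrow i).map_fun_eq_infinitePi_map₀' (hX i)]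

lemma integral_indicator_one_of_nullMeasurableSet {Ω : Type*} [MeasurableSpace Ω] {P : Measure Ω}
    {A : Set Ω} (hA : NullMeasurableSet A P) : ∫ ω, A.indicator 1 ω ∂P = P.real A := by
  simp [integral_indicator₀ hA]

/-- Conditioning on one of two independent variables: the probability of a joint event is the mean
over `X` of the probability of its section. -/
lemma IndepFun.measureReal_eq_integral {Ω E F : Type*} [MeasurableSpace Ω] [MeasurableSpace E]
    [MeasurableSpace F] {P : Measure Ω} [IsProbabilityMeasure P] {X : Ω → E} {W : Ω → F}
    (hX : AEMeasurable X P) (hW : AEMeasurable W P) (h : IndepFun X W P) {A : Set (E × F)}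
    (hA : MeasurableSet A) :
    AEStronglyMeasurable (fun ω => P.real {ω' | (X ω, W ω') ∈ A}) P ∧
      P.real {ω | (X ω, W ω) ∈ A} = ∫ ω, P.real {ω' | (X ω, W ω') ∈ A} ∂P := by
  have := Measure.isProbabilityMeasure_map hX
  have := Measure.isProbabilityMeasure_map hW
  have hsec : ∀ x, P {ω' | (x, W ω') ∈ A} = P.map W (Prod.mk x ⁻¹' A) := fun x => by
    rw [Measure.map_apply_of_aemeasurable hW (measurable_prodMk_left hA)]; rfl
  have hmeas : Measurable fun x => P.map W (Prod.mk x ⁻¹' A) := measurable_measure_prodMk_left hA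
  have hae : AEMeasurable (fun ω => P {ω' | (X ω, W ω') ∈ A}) P := by
    simp_rw [hsec]; exact hmeas.comp_aemeasurable hX
  refine ⟨hae.ennreal_toReal.aestronglyMeasurable, ?_⟩
  have hjoint : P {ω | (X ω, W ω) ∈ A} = ∫⁻ ω, P {ω' | (X ω, W ω') ∈ A} ∂P := by
    have : {ω | (X ω, W ω) ∈ A} = (fun ω => (X ω, W ω)) ⁻¹' A := rfl
    rw [this, ← Measure.map_apply_of_aemeasurable (hX.prodMk hW) hA,
      (indepFun_iff_map_prod_eq_prod_map_map hX hW).1 h, Measure.prod_apply hA,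
      lintegral_map' hmeas.aemeasurable hX]
    simp_rw [hsec]
  simp only [Measure.real]
  rw [hjoint, integral_toReal hae (ae_of_all _ fun ω => measure_lt_top _ _)]

/-! ### Iterated limits -/

/-- Dominated convergence for iterated limits: bounded iterated limits depending on a parameter may
be integrated over that parameter. -/
lemma HasIteratedLimit.integral {Ω : Type*} [MeasurableSpace Ω] {P : Measure Ω}
    [IsProbabilityMeasure P] {n : ℕ} {F : Ω → (Fin n → ℕ) → ℝ} {c : Ω → ℝ}
    (hF : ∀ M, AEStronglyMeasurable (fun ω => F ω M) P) (hF1 : ∀ ω M, |F ω M| ≤ 1)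
    (h : ∀ ω, HasIteratedLimit n (F ω) (c ω)) :
    AEStronglyMeasurable c P ∧ (∀ ω, |c ω| ≤ 1) ∧
      HasIteratedLimit n (fun M => ∫ ω, F ω M ∂P) (∫ ω, c ω ∂P) := by
  induction n generalizing c with
  | zero =>
    obtain rfl : (fun ω => F ω Fin.elim0) = c := funext h
    exact ⟨hF _, fun ω => hF1 _ _, rfl⟩
  | succ n ih =>
    choose g hg hlim using h
    have key := fun m (hm : 2 ≤ m) => ih (F := fun ω M => F ω (Fin.cons m M))
      (c := fun ω => g ω m) (fun M => hF _) (fun ω M => hF1 _ _) (fun ω => hg ω m hm)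
    refine ⟨?_, fun ω => ?_, fun m => ∫ ω, g ω m ∂P, fun m hm => (key m hm).2.2, ?_⟩
    · refine aestronglyMeasurable_of_tendsto_ae (f := fun m ω => g ω (m + 2)) atTop
        (fun m => (key (m + 2) (by omega)).1)
        (ae_of_all _ fun ω => (hlim ω).comp (tendsto_add_atTop_nat 2))
    · exact le_of_tendsto (hlim ω).abs
        (eventually_atTop.2 ⟨2, fun m hm => (key m hm).2.1 ω⟩)
    · refine tendsto_integral_filter_of_dominated_convergence (fun _ => 1)
        (eventually_atTop.2 ⟨2, fun m hm => (key m hm).1⟩)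
        (eventually_atTop.2 ⟨2, fun m hm => ae_of_all _ fun ω => (key m hm).2.1 ω⟩)
        (integrable_const _) (ae_of_all _ hlim)

/-! ### Several levels -/

/-- The limiting behaviour of a level with error `D m` and variance term `S m`, added to an error
`d` and a variance term `s`: the strict and the weak coverage events have a common limiting
probability, which is `1` or `0` if `d` is already inside or outside the bound, and
`erf (a / √2)` if `d = s = 0`. When `|d| = a * √s > 0` only the existence is recorded. -/
def HasCoverageLimit {Ω : Type*} [MeasurableSpace Ω] (P : Measure Ω) (a : ℝ)
    (D S : ℕ → Ω → ℝ) : Prop :=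
  ∀ d s : ℝ, 0 ≤ s → ∃ c : ℝ, 0 ≤ c ∧ c ≤ 1 ∧ (|d| < a * √s → c = 1) ∧
    (a * √s < |d| → c = 0) ∧ (d = 0 → s = 0 → c = erf (a / √2)) ∧
    Tendsto (fun m => P.real {ω | |d + D m ω| < a * √(s + S m ω)}) atTop (𝓝 c) ∧
    Tendsto (fun m => P.real {ω | |d + D m ω| ≤ a * √(s + S m ω)}) atTop (𝓝 c)

/-- The iterated coverage limit as a function `φ d s` of an error `d` and a variance term `s`
contributed by the sample sizes already fixed. The bounds on `φ` away from `|d| = a * √s` are what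
the induction needs: they squeeze the mean of `φ` over one further level between the probabilities
of its strict and weak coverage events. -/
theorem exists_hasIteratedLimit_coverage {Ω : Type*} [MeasurableSpace Ω] {P : Measure Ω}
    [IsProbabilityMeasure P] {a : ℝ} {n : ℕ} (D S : Fin n → ℕ → Ω → ℝ)
    (hD : ∀ l m, AEMeasurable (D l m) P) (hS : ∀ l m, AEMeasurable (S l m) P)
    (hS0 : ∀ l m ω, 0 ≤ S l m ω)
    (hind : ∀ M : Fin n → ℕ, iIndepFun (fun l ω => (D l (M l) ω, S l (M l) ω)) P)
    (hlev : ∀ l, (∀ m, 2 ≤ m → D l m =ᵐ[P] 0 ∧ S l m =ᵐ[P] 0) ∨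
      HasCoverageLimit P a (D l) (S l)) :
    ∃ φ : ℝ → ℝ → ℝ,
      (∀ d s, 0 ≤ s → HasIteratedLimit n
        (fun M => P.real {ω | |d + ∑ l, D l (M l) ω| ≤ a * √(s + ∑ l, S l (M l) ω)}) (φ d s)) ∧
      (∀ d s, 0 ≤ s → 0 ≤ φ d s ∧ φ d s ≤ 1 ∧
        (|d| < a * √s → φ d s = 1) ∧ (a * √s < |d| → φ d s = 0)) ∧
      ((∃ l, HasCoverageLimit P a (D l) (S l)) → φ 0 0 = erf (a / √2)) := by
  classical
  induction n with
  | zero =>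
    refine ⟨fun d s => if |d| ≤ a * √s then 1 else 0, fun d s _ => ?_, fun d s _ => ?_,
      fun ⟨l, _⟩ => l.elim0⟩
    · by_cases h : |d| ≤ a * √s <;> simp [HasIteratedLimit, h]
    · refine ⟨?_, ?_, fun h => if_pos h.le, fun h => if_neg h.not_ge⟩ <;> dsimp only <;>
        split_ifs <;> norm_num
  | succ n ih =>
    obtain ⟨φ, hφ, hφb, hφe⟩ := ih (fun l => D l.succ) (fun l => S l.succ)
      (fun l => hD _) (fun l => hS _) (fun l => hS0 _)
      (fun M => (hind (Fin.cons 0 M)).precomp (Fin.succ_injective n)) (fun l => hlev _)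
    -- The first level is independent of the others, so it can be integrated out last.
    have hstep : ∀ (d s : ℝ) (m : ℕ) (M : Fin n → ℕ),
        AEStronglyMeasurable (fun ω => P.real {ω' | |d + D 0 m ω + ∑ l, D l.succ (M l) ω'| ≤
          a * √(s + S 0 m ω + ∑ l, S l.succ (M l) ω')}) P ∧
        P.real {ω | |d + ∑ l, D l ((Fin.cons m M : Fin (n + 1) → ℕ) l) ω| ≤
          a * √(s + ∑ l, S l ((Fin.cons m M : Fin (n + 1) → ℕ) l) ω)} =
        ∫ ω, P.real {ω' | |d + D 0 m ω + ∑ l, D l.succ (M l) ω'| ≤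
          a * √(s + S 0 m ω + ∑ l, S l.succ (M l) ω')} ∂P := by
      intro d s m M
      set f : Fin (n + 1) → Ω → ℝ × ℝ := fun l ω =>
        (D l ((Fin.cons m M : Fin (n + 1) → ℕ) l) ω, S l ((Fin.cons m M : Fin (n + 1) → ℕ) l) ω)
      have hf : ∀ l, AEMeasurable (f l) P := fun l => (hD _ _).prodMk (hS _ _)
      have h0 : (0 : Fin (n + 1)) ∉ Finset.univ.map (Fin.succEmb n) := by simp
      have hi := ((hind (Fin.cons m M)).indepFun_finsetSum_of_notMem₀ hf h0).symm
      have hA : MeasurableSet {q : (ℝ × ℝ) × (ℝ × ℝ) |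
          |d + q.1.1 + q.2.1| ≤ a * √(s + q.1.2 + q.2.2)} :=
        measurableSet_le (by fun_prop) (by fun_prop)
      have := IndepFun.measureReal_eq_integral (hf 0)
        (Finset.aemeasurable_sum _ fun l _ => hf l) hi hA
      simpa [f, Finset.sum_apply, Prod.fst_sum, Prod.snd_sum, Fin.sum_univ_succ, add_assoc]
        using this
    have hlim : ∀ (d s : ℝ) (m : ℕ), 0 ≤ s →
        AEStronglyMeasurable (fun ω => φ (d + D 0 m ω) (s + S 0 m ω)) P ∧
        HasIteratedLimit n (fun M => P.real
          {ω | |d + ∑ l, D l ((Fin.cons m M : Fin (n + 1) → ℕ) l) ω| ≤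
            a * √(s + ∑ l, S l ((Fin.cons m M : Fin (n + 1) → ℕ) l) ω)})
          (∫ ω, φ (d + D 0 m ω) (s + S 0 m ω) ∂P) := by
      intro d s m hs
      have := HasIteratedLimit.integral (P := P) (fun M => (hstep d s m M).1)
        (fun ω M => by rw [abs_of_nonneg measureReal_nonneg]; exact measureReal_le_one)
        (fun ω => hφ (d + D 0 m ω) (s + S 0 m ω) (add_nonneg hs (hS0 0 m ω)))
      simp_rw [(hstep d s m _).2]
      exact ⟨this.1, this.2.2⟩
    by_cases hc : HasCoverageLimit P a (D 0) (S 0)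
    · choose! c hc0 hc1 hcin hcout hce hclt hcle using hc
      refine ⟨c, fun d s hs => ⟨_, fun m _ => (hlim d s m hs).2, ?_⟩,
        fun d s hs => ⟨hc0 d s hs, hc1 d s hs, hcin d s hs, hcout d s hs⟩,
        fun _ => hce 0 0 le_rfl rfl rfl⟩
      have hsum : ∀ m ω, 0 ≤ s + S 0 m ω := fun m ω => add_nonneg hs (hS0 0 m ω)
      have hφi : ∀ m, Integrable (fun ω => φ (d + D 0 m ω) (s + S 0 m ω)) P := fun m =>
        Integrable.of_bound (hlim d s m hs).1 1 (ae_of_all _ fun ω => by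
          rw [Real.norm_eq_abs, abs_of_nonneg (hφb _ _ (hsum m ω)).1]
          exact (hφb _ _ (hsum m ω)).2.1)
      have hmD : ∀ m, AEMeasurable (fun ω => |d + D 0 m ω|) P := fun m => by
        have := hD 0 m; fun_prop
      have hmS : ∀ m, AEMeasurable (fun ω => a * √(s + S 0 m ω)) P := fun m => by
        have := hS 0 m; fun_prop
      refine tendsto_of_tendsto_of_tendsto_of_le_of_le (hclt d s hs) (hcle d s hs)
        (fun m => ?_) (fun m => ?_)
      · have hn : NullMeasurableSet {ω | |d + D 0 m ω| < a * √(s + S 0 m ω)} P :=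
          nullMeasurableSet_lt (hmD m) (hmS m)
        simp only
        rw [← integral_indicator_one_of_nullMeasurableSet hn]
        refine integral_mono ((integrable_const 1).indicator₀ hn) (hφi m) fun ω => ?_
        obtain ⟨h0, -, h1, -⟩ := hφb (d + D 0 m ω) _ (hsum m ω)
        by_cases h : |d + D 0 m ω| < a * √(s + S 0 m ω)
        · simp [h, h1 h]
        · simpa [h] using h0
      · have hn : NullMeasurableSet {ω | |d + D 0 m ω| ≤ a * √(s + S 0 m ω)} P :=
          nullMeasurableSet_le (hmD m) (hmS m)
        simp only
        rw [← integral_indicator_one_of_nullMeasurableSet hn]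
        refine integral_mono (hφi m) ((integrable_const 1).indicator₀ hn) fun ω => ?_
        obtain ⟨-, h1, -, h0⟩ := hφb (d + D 0 m ω) _ (hsum m ω)
        by_cases h : |d + D 0 m ω| ≤ a * √(s + S 0 m ω)
        · simpa [h] using h1
        · simp [h, h0 (not_le.1 h)]
    · have hz := (hlev 0).resolve_right hc
      refine ⟨φ, fun d s hs => ⟨_, fun m _ => (hlim d s m hs).2, ?_⟩, hφb, fun ⟨l, hl⟩ => ?_⟩
      · refine tendsto_const_nhds.congr' (eventually_atTop.2 ⟨2, fun m hm => ?_⟩)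
        have : (fun ω => φ (d + D 0 m ω) (s + S 0 m ω)) =ᵐ[P] fun _ => φ d s := by
          filter_upwards [(hz m hm).1, (hz m hm).2] with ω h1 h2
          simp [h1, h2]
        simp [integral_congr_ae this]
      · refine hφe ?_
        induction l using Fin.cases with
        | zero => exact absurd hl hc
        | succ l => exact ⟨l, hl⟩

/-! ### The limit law of a single level -/

lemma gaussianReal_real_abs_lt_zero {a v : ℝ} (ha : 0 < a) (hv : 0 < v) :
    (gaussianReal 0 v.toNNReal).real {x | |x| < a * √v} = erf (a / √2) := by
  have hv' : v.toNNReal ≠ 0 := by simpa using hv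
  have hb : 0 < a * √v := by positivity
  have hset : {x : ℝ | |x| < a * √v} = Set.Ioo (-(a * √v)) (a * √v) := by
    ext x; simp [abs_lt]
  rw [Measure.real, gaussianReal_apply_eq_integral 0 hv', ENNReal.toReal_ofReal
    (integral_nonneg fun x => gaussianPDFReal_nonneg _ _ _), hset,
    ← integral_Ioc_eq_integral_Ioo, ← intervalIntegral.integral_of_le (by linarith)]
  have hi : ∀ x y, IntervalIntegrable (gaussianPDFReal 0 v.toNNReal) volume x y := fun x y =>
    (integrable_gaussianPDFReal 0 v.toNNReal).intervalIntegrable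
  have hneg : ∫ x in -(a * √v)..0, gaussianPDFReal 0 v.toNNReal x =
      ∫ x in 0..(a * √v), gaussianPDFReal 0 v.toNNReal x := by
    rw [← neg_zero, ← intervalIntegral.integral_comp_neg]
    simp [gaussianPDFReal]
  rw [← intervalIntegral.integral_add_adjacent_intervals (hi _ 0) (hi 0 _), hneg]
  have hc : (√(2 * v))⁻¹ ≠ 0 := by positivity
  have hpdf : ∀ x, gaussianPDFReal 0 v.toNNReal x =
      (√(2 * Real.pi * v))⁻¹ * Real.exp (-((√(2 * v))⁻¹ * x) ^ 2) := fun x => by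
    rw [gaussianPDFReal, Real.coe_toNNReal v hv.le, mul_pow, inv_pow, Real.sq_sqrt (by positivity)]
    congr 2
    field_simp
    ring
  simp_rw [hpdf]
  rw [intervalIntegral.integral_const_mul,
    intervalIntegral.integral_comp_mul_left (fun t => Real.exp (-t ^ 2)) hc, erf]
  have h1 : (√(2 * v))⁻¹ * (a * √v) = a / √2 := by
    rw [Real.sqrt_mul (by norm_num)]; field_simp
  rw [h1, mul_zero, smul_eq_mul, inv_inv, Real.sqrt_mul (by positivity),
    Real.sqrt_mul (by norm_num), Real.sqrt_mul (by norm_num)]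
  field_simp
  ring

/-- If the scaled margin `k m * (U m - B m)` converges in distribution to a variable without an atom
at `0`, the strict and the weak event `U m < B m`, `U m ≤ B m` have the same limiting
probability. -/
lemma tendsto_measureReal_lt_le_of_tendstoInDistribution {Ω Ω' : Type*} [MeasurableSpace Ω]
    [MeasurableSpace Ω'] {P : Measure Ω} [IsProbabilityMeasure P] {P' : Measure Ω'}
    [IsProbabilityMeasure P'] {U B : ℕ → Ω → ℝ} {k : ℕ → ℝ} {Z : Ω' → ℝ}
    (hk : ∀ᶠ m in atTop, 0 < k m)
    (hR : TendstoInDistribution (fun m ω => k m * (U m ω - B m ω)) atTop Z (fun _ => P) P')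
    (h0 : P' {ω | Z ω = 0} = 0) :
    Tendsto (fun m => P.real {ω | U m ω < B m ω}) atTop (𝓝 (P'.real {ω | Z ω < 0})) ∧
      Tendsto (fun m => P.real {ω | U m ω ≤ B m ω}) atTop (𝓝 (P'.real {ω | Z ω < 0})) := by
  have key : ∀ A : Set ℝ, MeasurableSet A → frontier A ⊆ {0} →
      Tendsto (fun m => P.real {ω | k m * (U m ω - B m ω) ∈ A}) atTop
        (𝓝 (P'.real {ω | Z ω ∈ A})) := by
    intro A hA hfr
    have hnull : P'.map Z (frontier A) = 0 := by
      refine measure_mono_null hfr ?_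
      rw [Measure.map_apply_of_aemeasurable hR.aemeasurable_limit (measurableSet_singleton 0)]
      exact h0
    have := (ENNReal.tendsto_toReal (a := P'.map Z A) (measure_ne_top _ _)).comp
      (ProbabilityMeasure.tendsto_measure_of_null_frontier_of_tendsto' hR.tendsto hnull)
    simp only [Function.comp_def, ProbabilityMeasure.coe_mk] at this
    rw [Measure.map_apply_of_aemeasurable hR.aemeasurable_limit hA] at this
    refine this.congr fun m => ?_
    rw [Measure.map_apply_of_aemeasurable (hR.forall_aemeasurable m) hA]
    rfl
  have hle : P'.real {ω | Z ω ≤ 0} = P'.real {ω | Z ω < 0} := by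
    refine measureReal_congr ?_
    filter_upwards [show ∀ᵐ ω ∂P', Z ω ≠ 0 by simpa [ae_iff] using h0] with ω hω
    exact propext ⟨fun h => lt_of_le_of_ne h hω, le_of_lt⟩
  constructor
  · refine (key (Set.Iio 0) measurableSet_Iio (by simp)).congr' ?_
    filter_upwards [hk] with m hm
    congr 1; ext ω
    simp [mul_neg_iff, hm, hm.not_gt]
  · have := key (Set.Iic 0) measurableSet_Iic (by simp)
    simp only [Set.mem_Iic, hle] at this
    refine this.congr' ?_
    filter_upwards [hk] with m hm
    congr 1; ext ω
    simp [mul_nonpos_iff, hm.not_ge, hm.le]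

/-- A level whose error `D m` satisfies the central limit theorem with variance `v > 0`, and whose
variance term `S m` is asymptotically `v / m`, has a coverage limit. Off the boundary
`|d| = a * √s` the laws of large numbers decide; at the origin the bound scales like the error; at
a boundary point with `s > 0` the bound moves by `O(1 / m)` only, which is negligible against the
error of order `1 / √m`, so the sign of the limiting normal variable decides. -/
theorem hasCoverageLimit_of_tendstoInDistribution {Ω : Type*} [MeasurableSpace Ω] {P : Measure Ω}
    [IsProbabilityMeasure P] {a v : ℝ} (ha : 0 < a) (hv : 0 < v) {D S : ℕ → Ω → ℝ}
    (hD : ∀ m, AEMeasurable (D m) P) (hS : ∀ m, AEMeasurable (S m) P) (hS0 : ∀ m ω, 0 ≤ S m ω)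
    (hclt : TendstoInDistribution (fun (m : ℕ) ω => √m * D m ω) atTop (fun x : ℝ => x)
      (fun _ => P) (gaussianReal 0 v.toNNReal))
    (hDlim : ∀ᵐ ω ∂P, Tendsto (fun m => D m ω) atTop (𝓝 0))
    (hSlim : ∀ᵐ ω ∂P, Tendsto (fun m : ℕ => m * S m ω) atTop (𝓝 v)) :
    HasCoverageLimit P a D S := by
  have hv' : v.toNNReal ≠ 0 := by simpa using hv
  have := nullSingletonClass_gaussianReal (μ := 0) hv'
  have hsq : Tendsto (fun m : ℕ => √(m : ℝ)) atTop atTop :=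
    Real.tendsto_sqrt_atTop.comp tendsto_natCast_atTop_atTop
  have hsqpos : ∀ᶠ m : ℕ in atTop, 0 < √(m : ℝ) := hsq.eventually_gt_atTop 0
  have hroot : ∀ᵐ ω ∂P, Tendsto (fun m : ℕ => √m * S m ω) atTop (𝓝 0) := by
    filter_upwards [hSlim] with ω hω
    refine (hω.div_atTop hsq).congr' ?_
    filter_upwards [hsqpos] with m hm
    rw [div_eq_iff hm.ne']
    linear_combination -S m ω * Real.mul_self_sqrt (Nat.cast_nonneg m)
  have hS0lim : ∀ᵐ ω ∂P, Tendsto (fun m => S m ω) atTop (𝓝 0) := by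
    filter_upwards [hroot] with ω hω
    refine (hω.div_atTop hsq).congr' ?_
    filter_upwards [hsqpos] with m hm
    field_simp
  intro d s hs
  rcases ne_or_eq |d| (a * √s) with hne | heq
  · have hR : TendstoInDistribution
        (fun (m : ℕ) ω => 1 * (|d + D m ω| - a * √(s + S m ω))) atTop
        (fun _ : Ω => |d| - a * √s) (fun _ => P) P := by
      refine tendstoInDistribution_of_ae_tendsto
        (fun m => by have := hD m; have := hS m; fun_prop) aemeasurable_const ?_
      filter_upwards [hDlim, hS0lim] with ω h1 h2
      simpa using ((h1.const_add d).abs).sub (((h2.const_add s).sqrt).const_mul a)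
    have h := tendsto_measureReal_lt_le_of_tendstoInDistribution (by simp) hR
      (by simp [sub_ne_zero.2 hne])
    refine ⟨_, measureReal_nonneg, measureReal_le_one, fun h => ?_, fun h => ?_,
      fun h1 h2 => ?_, h⟩
    · simp [h]
    · simp [h.not_gt]
    · simp [h1, h2] at hne
  · rcases hs.eq_or_lt with rfl | hs
    · obtain rfl : d = 0 := by simpa using heq
      have hV : ∀ᵐ ω ∂P, Tendsto (fun m : ℕ => √(m * S m ω)) atTop (𝓝 √v) := by
        filter_upwards [hSlim] with ω hω using hω.sqrt
      have hVm : ∀ m : ℕ, AEMeasurable (fun ω => √(m * S m ω)) P := fun m => by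
        have := hS m; fun_prop
      have hR := hclt.continuous_comp_prodMk_of_tendstoInMeasure_const
        (g := fun x : ℝ × ℝ => |x.1| - a * x.2) (by fun_prop)
        (tendstoInMeasure_of_tendsto_ae (fun m => (hVm m).aestronglyMeasurable) hV) hVm
      have hR' : TendstoInDistribution
          (fun (m : ℕ) ω => √m * (|0 + D m ω| - a * √(0 + S m ω))) atTop
          (fun x : ℝ => |x| - a * √v) (fun _ => P) (gaussianReal 0 v.toNNReal) := by
        refine hR.congr (fun m => ae_of_all _ fun ω => ?_) (ae_of_all _ fun _ => rfl)
        simp only [zero_add, abs_mul, abs_of_nonneg (Real.sqrt_nonneg _),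
          Real.sqrt_mul (Nat.cast_nonneg m)]
        ring
      have h := tendsto_measureReal_lt_le_of_tendstoInDistribution hsqpos hR' (by
        refine ((Set.toFinite {a * √v, -(a * √v)}).subset fun x hx => ?_).measure_zero _
        exact eq_or_eq_neg_of_abs_eq (sub_eq_zero.1 hx))
      simp only [sub_neg, gaussianReal_real_abs_lt_zero ha hv] at h
      refine ⟨_, ?_, ?_, fun h => ?_, fun h => ?_, fun _ _ => rfl, h⟩
      · exact ge_of_tendsto' h.1 fun _ => measureReal_nonneg
      · exact le_of_tendsto' h.1 fun _ => measureReal_le_one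
      · simp at h
      · simp at h
    · have hbd : 0 < |d| := by rw [heq]; positivity
      have hd : d ≠ 0 := abs_pos.1 hbd
      -- `σ` is the sign of `d`; the scaled margin converges in distribution to `σ` times a normal
      -- variable.
      obtain ⟨σ, hσ, hσd⟩ : ∃ σ : ℝ, |σ| = 1 ∧ σ * d = |d| := by
        rcases hd.lt_or_gt with h | h
        · exact ⟨-1, by simp, by simp [abs_of_neg h]⟩
        · exact ⟨1, by simp, by simp [abs_of_pos h]⟩
      have hσ0 : σ ≠ 0 := by rintro rfl; simp at hσ
      -- The part of the scaled margin that is not linear in the error is negligible.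
      have he : ∀ᵐ ω ∂P, Tendsto (fun m : ℕ =>
          √m * (|d + D m ω| - a * √(s + S m ω)) - σ * (√m * D m ω)) atTop (𝓝 0) := by
        filter_upwards [hDlim, hS0lim, hroot] with ω h1 h2 h3
        have hden : Tendsto (fun m => √(s + S m ω) + √s) atTop (𝓝 (√s + √s)) := by
          simpa using ((h2.const_add s).sqrt).add_const √s
        have hq := ((h3.div hden (by positivity)).const_mul (-a))
        simp only [zero_div, mul_zero] at hq
        refine hq.congr' ?_
        filter_upwards [h1.abs.eventually_lt_const (u := |d|) (by simpa using hd)] with m hm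
        have habs : |d + D m ω| = |d| + σ * D m ω := by
          have h4 : |σ * D m ω| < |d| := by rw [abs_mul, hσ, one_mul]; exact hm
          rw [← one_mul |d + D m ω|, ← hσ, ← abs_mul, mul_add, hσd,
            abs_of_pos (by linarith [neg_abs_le (σ * D m ω)])]
        have hpos : 0 < √(s + S m ω) + √s :=
          add_pos_of_nonneg_of_pos (Real.sqrt_nonneg _) (Real.sqrt_pos.2 hs)
        have hdiff : S m ω / (√(s + S m ω) + √s) = √(s + S m ω) - √s := by
          rw [div_eq_iff hpos.ne']
          linear_combination Real.mul_self_sqrt hs.le -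
            Real.mul_self_sqrt (add_nonneg hs.le (hS0 m ω))
        rw [Pi.div_apply, mul_div_assoc, hdiff, habs, heq]
        ring
      have hem : ∀ m : ℕ, AEMeasurable (fun ω =>
          √m * (|d + D m ω| - a * √(s + S m ω)) - σ * (√m * D m ω)) P := fun m => by
        have := hD m; have := hS m; fun_prop
      have hR := hclt.continuous_comp_prodMk_of_tendstoInMeasure_const
        (g := fun x : ℝ × ℝ => σ * x.1 + x.2) (by fun_prop)
        (tendstoInMeasure_of_tendsto_ae (fun m => (hem m).aestronglyMeasurable) he) hem
      have hR' : TendstoInDistribution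
          (fun (m : ℕ) ω => √m * (|d + D m ω| - a * √(s + S m ω))) atTop
          (fun x : ℝ => σ * x) (fun _ => P) (gaussianReal 0 v.toNNReal) := by
        refine hR.congr (fun m => ae_of_all _ fun ω => ?_) (ae_of_all _ fun _ => ?_)
        · simp
        · simp
      have h := tendsto_measureReal_lt_le_of_tendstoInDistribution hsqpos hR' (by simp [hσ0])
      exact ⟨_, measureReal_nonneg, measureReal_le_one, fun h => absurd h heq.not_lt,
        fun h => absurd h heq.not_gt, fun h => absurd h hd, h⟩

/-! ### Sample means and sample variances -/

lemma aemeasurable_sampleMean {Ω Λ : Type*} [MeasurableSpace Ω] {P : Measure Ω} {f : Λ → ℝ}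
    {Y : ℕ → Ω → Λ} (h : ∀ m, AEMeasurable (fun ω => f (Y m ω)) P) (M : ℕ) :
    AEMeasurable (sampleMean f Y M) P :=
  (Finset.aemeasurable_fun_sum _ fun m _ => h m).const_mul _

lemma aemeasurable_sampleVariance {Ω Λ : Type*} [MeasurableSpace Ω] {P : Measure Ω} {f : Λ → ℝ}
    {Y : ℕ → Ω → Λ} (h : ∀ m, AEMeasurable (fun ω => f (Y m ω)) P) (M : ℕ) :
    AEMeasurable (sampleVariance f Y M) P :=
  (Finset.aemeasurable_fun_sum _ fun m _ =>
    ((aemeasurable_sampleMean h M).sub (h m)).pow_const 2).const_mul _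

/-- For `M = 0` the sum is empty, so that the negative factor `1 / (0 - 1)` does no harm. -/
lemma sampleVariance_nonneg {Ω Λ : Type*} (f : Λ → ℝ) (Y : ℕ → Ω → Λ) (M : ℕ) (ω : Ω) :
    0 ≤ sampleVariance f Y M ω := by
  rcases M.eq_zero_or_pos with rfl | hM
  · simp [sampleVariance]
  · have : (1 : ℝ) ≤ M := by exact_mod_cast hM
    exact mul_nonneg (by simpa using this) (Finset.sum_nonneg fun _ _ => sq_nonneg _)

lemma sampleVariance_eq {Ω Λ : Type*} {f : Λ → ℝ} {Y : ℕ → Ω → Λ} {M : ℕ} (hM : M ≠ 0) (ω : Ω) :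
    sampleVariance f Y M ω = M / ((M : ℝ) - 1) *
      ((∑ m ∈ Finset.range M, f (Y m ω) ^ 2) / M - sampleMean f Y M ω ^ 2) := by
  have hM' : (M : ℝ) ≠ 0 := by exact_mod_cast hM
  have hs : ∑ m ∈ Finset.range M, f (Y m ω) = M * sampleMean f Y M ω := by
    rw [sampleMean]; field_simp
  simp only [sampleVariance, sub_sq, Finset.sum_add_distrib, Finset.sum_sub_distrib,
    ← Finset.mul_sum, hs, Finset.sum_const, Finset.card_range, nsmul_eq_mul]
  field_simp
  ring

section Sampling

variable {Ω Λ : Type*} [MeasurableSpace Ω] [MeasurableSpace Λ] {P : Measure Ω} {μ : Measure Λ}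
  {f : Λ → ℝ} {Y : ℕ → Ω → Λ}

lemma integral_sampleMean (hf : Integrable f μ)
    (hid : ∀ m, IdentDistrib (fun ω => f (Y m ω)) f P μ) {M : ℕ} (hM : M ≠ 0) :
    Integrable (sampleMean f Y M) P ∧ ∫ ω, sampleMean f Y M ω ∂P = ∫ y, f y ∂μ := by
  have hi : ∀ m, Integrable (fun ω => f (Y m ω)) P := fun m => (hid m).integrable_iff.2 hf
  have hM' : (M : ℝ) ≠ 0 := by exact_mod_cast hM
  refine ⟨(integrable_finsetSum _ fun m _ => hi m).const_mul _, ?_⟩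
  simp only [sampleMean]
  rw [integral_const_mul, integral_finsetSum _ fun m _ => hi m]
  simp only [(hid _).integral_eq, Finset.sum_const, Finset.card_range, nsmul_eq_mul]
  field_simp

lemma ae_tendsto_sampleMean (hf : Integrable f μ)
    (hid : ∀ m, IdentDistrib (fun ω => f (Y m ω)) f P μ)
    (hind : iIndepFun (fun m ω => f (Y m ω)) P) :
    ∀ᵐ ω ∂P, Tendsto (fun M => sampleMean f Y M ω) atTop (𝓝 (∫ y, f y ∂μ)) := by
  have := strong_law_ae_real (fun m ω => f (Y m ω)) ((hid 0).integrable_iff.2 hf)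
    (fun i j hij => hind.indepFun hij) (fun m => (hid m).trans (hid 0).symm)
  rw [(hid 0).integral_eq] at this
  filter_upwards [this] with ω hω
  exact hω.congr fun M => by rw [sampleMean, one_div, div_eq_inv_mul]

lemma ae_tendsto_sampleVariance [IsProbabilityMeasure μ] (hf : MemLp f 2 μ)
    (hid : ∀ m, IdentDistrib (fun ω => f (Y m ω)) f P μ)
    (hind : iIndepFun (fun m ω => f (Y m ω)) P) :
    ∀ᵐ ω ∂P, Tendsto (fun M => sampleVariance f Y M ω) atTop (𝓝 Var[f; μ]) := by
  have hsq := ae_tendsto_sampleMean (f := fun y => f y ^ 2) hf.integrable_sq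
    (fun m => (hid m).comp (measurable_id.pow_const 2))
    (hind.comp (fun _ x => x ^ 2) fun _ => measurable_id.pow_const 2)
  have hratio : Tendsto (fun M : ℕ => (M : ℝ) / ((M : ℝ) - 1)) atTop (𝓝 1) := by
    have := tendsto_natCast_div_add_atTop (𝕜 := ℝ) (-1)
    simpa [sub_eq_add_neg] using this
  filter_upwards [hsq, ae_tendsto_sampleMean (hf.integrable one_le_two) hid hind] with ω h1 h2
  have := hratio.mul (h1.sub (h2.pow 2))
  rw [one_mul, ← show Var[f; μ] = (∫ y, f y ^ 2 ∂μ) - (∫ y, f y ∂μ) ^ 2 from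
    variance_eq_sub hf] at this
  refine this.congr' ?_
  filter_upwards [eventually_ne_atTop 0] with M hM
  rw [sampleVariance_eq hM, sampleMean, one_div, div_eq_inv_mul _ (M : ℝ)]

/-- A level of zero variance contributes neither an error nor a variance term. -/
lemma ae_eq_zero_of_variance_eq_zero [IsProbabilityMeasure μ] (hf : MemLp f 2 μ)
    (hid : ∀ m, IdentDistrib (fun ω => f (Y m ω)) f P μ) (hv : Var[f; μ] = 0) {M : ℕ}
    (hM : M ≠ 0) :
    (fun ω => (∫ y, f y ∂μ) - sampleMean f Y M ω) =ᵐ[P] 0 ∧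
      (fun ω => sampleVariance f Y M ω / M) =ᵐ[P] 0 := by
  have hM' : (M : ℝ) ≠ 0 := by exact_mod_cast hM
  have hc : ∀ᵐ ω ∂P, ∀ m, f (Y m ω) = ∫ y, f y ∂μ := ae_all_iff.2 fun m =>
    (hid m).symm.ae_snd (p := fun x => x = ∫ y, f y ∂μ) (measurableSet_singleton _)
      (ae_eq_integral_of_variance_eq_zero hf hv)
  have hmean : ∀ᵐ ω ∂P, sampleMean f Y M ω = ∫ y, f y ∂μ := by
    filter_upwards [hc] with ω hω
    simp [sampleMean, hω, hM']
  constructor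
  · filter_upwards [hmean] with ω hω
    simp [hω]
  · filter_upwards [hc, hmean] with ω h1 h2
    simp [sampleVariance, h1, h2]

lemma hasCoverageLimit_of_variance_ne_zero [IsProbabilityMeasure P] [IsProbabilityMeasure μ]
    (hf : MemLp f 2 μ) (hid : ∀ m, IdentDistrib (fun ω => f (Y m ω)) f P μ)
    (hind : iIndepFun (fun m ω => f (Y m ω)) P) (hv : Var[f; μ] ≠ 0) {a : ℝ} (ha : 0 < a) :
    HasCoverageLimit P a (fun M ω => (∫ y, f y ∂μ) - sampleMean f Y M ω)
      (fun M ω => sampleVariance f Y M ω / M) := by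
  have hm : ∀ m, AEMeasurable (fun ω => f (Y m ω)) P := fun m => (hid m).aemeasurable_fst
  refine hasCoverageLimit_of_tendstoInDistribution ha
    (lt_of_le_of_ne (variance_nonneg f μ) hv.symm)
    (fun M => (aemeasurable_sampleMean hm M).const_sub _)
    (fun M => (aemeasurable_sampleVariance hm M).div_const _)
    (fun M ω => div_nonneg (sampleVariance_nonneg f Y M ω) (Nat.cast_nonneg M)) ?_ ?_ ?_
  · have hvar : Var[fun ω => -f (Y 0 ω); P] = Var[f; μ] := by
      rw [variance_fun_neg, (hid 0).variance_eq]
    -- The central limit theorem for `-f`, because the error is the mean minus the sample mean.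
    have h := tendstoInDistribution_inv_sqrt_mul_sum_sub (P := P) (X := fun m ω => -f (Y m ω))
      (Y := fun x : ℝ => x) (P' := gaussianReal 0 Var[f; μ].toNNReal)
      (by rw [hvar]; exact HasLaw.id) ((hid 0).memLp_iff.2 hf).neg
      (hind.comp (fun _ x => -x) fun _ => measurable_neg)
      (fun m => ((hid m).trans (hid 0).symm).comp measurable_neg)
    refine h.congr (fun M => ae_of_all _ fun ω => ?_) (ae_of_all _ fun _ => rfl)
    rcases M.eq_zero_or_pos with rfl | hM
    · simp
    · have hM' : (0 : ℝ) < M := by exact_mod_cast hM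
      simp only [sampleMean, integral_neg, (hid 0).integral_eq, Finset.sum_neg_distrib]
      have hs := Real.sq_sqrt hM'.le
      have : √(M : ℝ) ≠ 0 := (Real.sqrt_pos.2 hM').ne'
      field_simp
      rw [hs]
      ring
  · filter_upwards [ae_tendsto_sampleMean (hf.integrable one_le_two) hid hind] with ω hω
    simpa using hω.const_sub (∫ y, f y ∂μ)
  · filter_upwards [ae_tendsto_sampleVariance hf hid hind] with ω hω
    refine hω.congr' ?_
    filter_upwards [eventually_ne_atTop 0] with M hM
    have hM' : (M : ℝ) ≠ 0 := by exact_mod_cast hM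
    field_simp

end Sampling

/-! ### The multilevel estimate -/

lemma memLp_levelDiff {Λ : Type*} [MeasurableSpace Λ] {μ : Measure Λ} {L : ℕ} {sh : Λ → ℝ}
    {sN : Fin L → Λ → ℝ} (hsh : MemLp sh 2 μ) (hsN : ∀ i, MemLp (sN i) 2 μ) (l : Fin (L + 1)) :
    MemLp (levelDiff sh sN l) 2 μ := by
  refine MemLp.sub (f := (Fin.cons sh sN : Fin (L + 1) → Λ → ℝ) l)
    (g := (Fin.snoc sN (fun _ => 0) : Fin (L + 1) → Λ → ℝ) l) ?_ ?_
  · induction l using Fin.cases with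
    | zero => exact hsh
    | succ i => exact hsN i
  · induction l using Fin.lastCases with
    | last => simp [MemLp.zero']
    | cast i => simpa using hsN i

lemma sum_levelDiff {Λ : Type*} {L : ℕ} (sh : Λ → ℝ) (sN : Fin L → Λ → ℝ) (y : Λ) :
    ∑ l, levelDiff sh sN l y = sh y := by
  simp only [levelDiff, Finset.sum_sub_distrib]
  rw [Fin.sum_univ_succ, Fin.sum_univ_castSucc (fun l =>
    (Fin.snoc sN (fun _ => 0) : Fin (L + 1) → Λ → ℝ) l y)]
  simp

theorem mainTheorem2 {Ω Λ : Type*} [MeasurableSpace Ω] [MeasurableSpace Λ]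
    (P : Measure Ω) [IsProbabilityMeasure P] (μ : Measure Λ) [IsProbabilityMeasure μ]
    (L : ℕ) (sh : Λ → ℝ) (sN : Fin L → Λ → ℝ)
    (hsh : MemLp sh 2 μ) (hsN : ∀ i, MemLp (sN i) 2 μ)
    (Y : Fin (L + 1) → ℕ → Ω → Λ)
    (hlaw : ∀ l m, HasLaw (Y l m) μ P)
    (hindep : iIndepFun (fun (p : Fin (L + 1) × ℕ) => Y p.1 p.2) P) :
    (∀ M : Fin (L + 1) → ℕ, (∀ l, 1 ≤ M l) →
      Integrable (mvrEstimate sh sN Y M) P ∧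
        ∫ ω, mvrEstimate sh sN Y M ω ∂P = ∫ y, sh y ∂μ) ∧
    ((∃ l, Var[levelDiff sh sN l; μ] ≠ 0) → ∀ a : ℝ, 0 < a →
      HasIteratedLimit (L + 1)
        (fun M => P.real {ω | |(∫ y, sh y ∂μ) - mvrEstimate sh sN Y M ω| ≤
          mvrErrorBound a sh sN Y M ω})
        (erf (a / Real.sqrt 2))) := by
  set z := levelDiff sh sN with hz_def
  have hz : ∀ l, MemLp (z l) 2 μ := memLp_levelDiff hsh hsN
  have hid : ∀ l m, IdentDistrib (fun ω => z l (Y l m ω)) (z l) P μ := fun l m =>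
    IdentDistrib.comp_of_aemeasurable (f := Y l m) (g := id) (u := z l)
      ⟨(hlaw l m).aemeasurable, aemeasurable_id, by rw [(hlaw l m).map_eq, Measure.map_id]⟩
      (by rw [(hlaw l m).map_eq]; exact (hz l).aemeasurable)
  have hm : ∀ l m, AEMeasurable (fun ω => z l (Y l m ω)) P := fun l m => (hid l m).aemeasurable_fst
  have hE : ∫ y, sh y ∂μ = ∑ l, ∫ y, z l y ∂μ := by
    rw [← integral_finsetSum _ fun l _ => (hz l).integrable one_le_two]
    simp_rw [hz_def, sum_levelDiff]
  refine ⟨fun M hM => ?_, fun ⟨l₀, hl₀⟩ a ha => ?_⟩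
  · have h := fun l => integral_sampleMean ((hz l).integrable one_le_two) (hid l)
      (Nat.one_le_iff_ne_zero.1 (hM l))
    refine ⟨integrable_finsetSum _ fun l _ => (h l).1, ?_⟩
    simp only [mvrEstimate, ← hz_def]
    rw [integral_finsetSum _ fun l _ => (h l).1, hE]
    exact Finset.sum_congr rfl fun l _ => (h l).2
  · have hU : iIndepFun (fun (p : Fin (L + 1) × ℕ) ω => z p.1 (Y p.1 p.2 ω)) P :=
      hindep.comp₀ (fun p => z p.1) (fun p => (hlaw p.1 p.2).aemeasurable)
        (fun p => by rw [(hlaw p.1 p.2).map_eq]; exact (hz p.1).aemeasurable)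
    have hrow : ∀ l, iIndepFun (fun m ω => z l (Y l m ω)) P := fun l =>
      hU.precomp (g := fun m => (l, m)) (fun _ _ h => (Prod.ext_iff.1 h).2)
    have hcov : ∀ l, Var[z l; μ] ≠ 0 → HasCoverageLimit P a
        (fun M ω => (∫ y, z l y ∂μ) - sampleMean (z l) (Y l) M ω)
        (fun M ω => sampleVariance (z l) (Y l) M ω / M) := fun l hl =>
      hasCoverageLimit_of_variance_ne_zero (hz l) (hid l) (hrow l) hl ha
    obtain ⟨φ, hφ, -, hφe⟩ := exists_hasIteratedLimit_coverage (P := P) (a := a)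
      (fun l M ω => (∫ y, z l y ∂μ) - sampleMean (z l) (Y l) M ω)
      (fun l M ω => sampleVariance (z l) (Y l) M ω / M)
      (fun l M => (aemeasurable_sampleMean (hm l) M).const_sub _)
      (fun l M => (aemeasurable_sampleVariance (hm l) M).div_const _)
      (fun l M ω => div_nonneg (sampleVariance_nonneg _ _ _ _) (Nat.cast_nonneg M))
      (fun M => by
        -- Error and variance term of a level are functions of the whole sample sequence of it.
        refine (iIndepFun_curry (X := fun l m ω => z l (Y l m ω)) hm hU).comp
          (fun l u => ((∫ y, z l y ∂μ) - sampleMean id (fun m (u : ℕ → ℝ) => u m) (M l) u,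
            sampleVariance id (fun m (u : ℕ → ℝ) => u m) (M l) u / M l)) fun l => ?_
        simp only [sampleVariance, sampleMean, id]
        fun_prop)
      (fun l => by
        by_cases hl : Var[z l; μ] = 0
        · exact Or.inl fun M hM => ae_eq_zero_of_variance_eq_zero (hz l) (hid l) hl (by omega)
        · exact Or.inr (hcov l hl))
    have h := hφ 0 0 le_rfl
    rw [hφe ⟨l₀, hcov l₀ hl₀⟩] at h
    simpa only [zero_add, Finset.sum_sub_distrib, ← hE, mvrEstimate, mvrErrorBound] using h
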